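/- Let $M$ be a matroid on a finite ground set $E$, with rank $r=r(M)$, independent sets $\mathcal I(M)$ and set of bases $\mathcal B(M)$. Regard $\mathcal I(M)$ as a simplicial complex on $E$. The augmented Bergman complex $\Delta_M$ is the simplicial complex on the vertex set $\{y_i : i\in E\}\sqcup\{x_F : F \text{ a flat of } M,\ F\neq E\}$ whose simplices are the sets $\{y_i\}_{i\in I}\cup\{x_{F_1},\dots,x_{F_\ell}\}$ with $\ell\ge 0$, $I\in\mathcal I(M)$ and proper flats $I\subseteq F_1\subsetneq F_2\subsetneq\cdots\subsetneq F_\ell\subsetneq E$. Let $\operatorname{Aut}(M)$ be the group of bijections $\sigma:E\to E$ with $\sigma(I)\in\mathcal I(M)$ for all $I\in\mathcal I(M)$; it acts on $\mathcal I(M)$ by $i\mapsto\sigma(i)$ and on $\Delta_M$ by $y_i\mapsto y_{\sigma(i)}$, $x_F\mapsto x_{\sigma(F)}$. For a simplicial complex $\Delta$, let $\tilde C_d(\Delta,\mathbb Z)$ be the group of oriented simplicial chains, with $[v_{w(0)},\dots,v_{w(d)}]=\operatorname{sgn}(w)\,[v_0,\dots,v_d]$ for permutations $w$ (and $\tilde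 C_{-1}=\mathbb Z$), and let $\tilde H_d(\Delta,\mathbb Z)$ be the resulting reduced simplicial homology. Then there is an isomorphism of $\mathbb Z$-linear representations of $\operatorname{Aut}(M)$ $$\Phi:\ \tilde H_{r-1}(\Delta_M,\mathbb Z)\ \xrightarrow{\ \sim\ }\ \tilde C_{r-1}(\mathcal I(M),\mathbb Z).$$ Consequently, for every choice of an ordering $(v^B_1,\dots,v^B_r)$ of each basis $B\in\mathcal B(M)$, the group $\tilde H_{r-1}(\Delta_M,\mathbb Z)$ has a $\mathbb Z$-basis $([B])_{B\in\mathcal B(M)}$ with $\Phi([B])=[v^B_1,\dots,v^B_r]$, on which $\operatorname{Aut}(M)$ acts by signed permutations: for $g\in\operatorname{Aut}(M)$ and $B\in\mathcal B(M)$, the set $B'=g(B)$ is a basis of $M$ and $$g\cdot[B]=\operatorname{sgn}(w)\,[B'],$$ where $w$ is the permutation of $\{1,\dots,r\}$ with $g(v^B_i)=v^{B'}_{w(i)}$ for all $i$. -/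

import Mathlib

noncomputable section

namespace PreAbstractSimplicialComplex

variable {V : Type*}

/-- Faces of `K`, the empty face included (`PreAbstractSimplicialComplex` only records the
nonempty faces). -/
def IsFace (K : PreAbstractSimplicialComplex V) (s : Finset V) : Prop :=
  s = ∅ ∨ s ∈ K

/-- `v = (v₀, …, vₙ₋₁)` lists, without repetition, the vertices of a face of `K`
(a face of dimension `n - 1`). -/
def IsOrderedSimplex (K : PreAbstractSimplicialComplex V) {n : ℕ} (v : Fin n → V) : Prop :=
  ∃ hv : Function.Injective v, K.IsFace (Finset.univ.map ⟨v, hv⟩)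

/-- The (augmented) oriented simplicial chain group of degree `n - 1` of a finite simplicial
complex `K`, with integer coefficients; `n` is the number of vertices of the simplices, so that
`n = 0` is the augmentation degree `-1`. As in Munkres, a chain is an integer-valued function `c`
on ordered simplices which is alternating under reordering of the vertices; it is extended by zero
to the tuples that are not ordered simplices of `K`. It is the free abelian group on the oriented
simplices `[v₀, …, vₙ₋₁]`, one for each face with `n` vertices, see `orientedSimplex`. -/
def chain (K : PreAbstractSimplicialComplex V) (n : ℕ) : Submodule ℤ ((Fin n → V) → ℤ) where
  carrier := {c | (∀ v, ¬ K.IsOrderedSimplex v → c v = 0) ∧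
    ∀ (v : Fin n → V) (w : Equiv.Perm (Fin n)), c (v ∘ w) = (Equiv.Perm.sign w : ℤ) * c v}
  add_mem' := by
    rintro a b ⟨ha, ha'⟩ ⟨hb, hb'⟩
    refine ⟨fun v hv => by simp [ha v hv, hb v hv], fun v w => ?_⟩
    simp only [Pi.add_apply, ha', hb']
    ring
  zero_mem' := ⟨fun _ _ => rfl, fun _ _ => by simp⟩
  smul_mem' := by
    rintro r a ⟨ha, ha'⟩
    refine ⟨fun v hv => by simp [ha v hv], fun v w => ?_⟩
    simp only [Pi.smul_apply, ha', smul_eq_mul]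
    ring

theorem IsOrderedSimplex.comp_perm {K : PreAbstractSimplicialComplex V} {n : ℕ} {v : Fin n → V}
    (h : K.IsOrderedSimplex v) (w : Equiv.Perm (Fin n)) : K.IsOrderedSimplex (v ∘ w) := by
  obtain ⟨hv, hf⟩ := h
  refine ⟨hv.comp w.injective, ?_⟩
  convert hf using 1
  ext x
  simp only [Finset.mem_map, Finset.mem_univ, true_and, Function.Embedding.coeFn_mk,
    Function.comp_apply]
  exact ⟨fun ⟨i, hi⟩ => ⟨w i, hi⟩, fun ⟨i, hi⟩ => ⟨w.symm i, by simpa using hi⟩⟩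

theorem IsOrderedSimplex.comp_injective {K : PreAbstractSimplicialComplex V} {m n : ℕ}
    {v : Fin n → V} (h : K.IsOrderedSimplex v) {f : Fin m → Fin n} (hf : Function.Injective f) :
    K.IsOrderedSimplex (v ∘ f) := by
  obtain ⟨hv, hs⟩ := h
  refine ⟨hv.comp hf, ?_⟩
  have hsub : Finset.univ.map ⟨v ∘ f, hv.comp hf⟩ ⊆ Finset.univ.map ⟨v, hv⟩ := by
    intro x hx
    simp only [Finset.mem_map, Finset.mem_univ, true_and, Function.Embedding.coeFn_mk,
      Function.comp_apply] at hx ⊢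
    obtain ⟨i, hi⟩ := hx
    exact ⟨f i, hi⟩
  rcases Finset.eq_empty_or_nonempty (Finset.univ.map ⟨v ∘ f, hv.comp hf⟩) with he | hne
  · exact Or.inl he
  · rcases hs with hs | hs
    · rw [hs] at hsub
      exact Or.inl (Finset.subset_empty.mp hsub)
    · exact Or.inr ((K.isRelLowerSet_faces hs).2 hsub hne)

open Classical in
/-- The oriented simplex `[v₀, …, vₙ₋₁]`: the chain which takes the value `sign w` on
`(v_{w 0}, …, v_{w (n-1)})` for each permutation `w` and vanishes on all other tuples. -/
def orientedSimplex (K : PreAbstractSimplicialComplex V) {n : ℕ} (v : Fin n → V)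
    (hv : K.IsOrderedSimplex v) : K.chain n :=
  ⟨fun t => ∑ w : Equiv.Perm (Fin n), if t = v ∘ w then (Equiv.Perm.sign w : ℤ) else 0, by
    refine ⟨fun t ht => Finset.sum_eq_zero fun w _ => ?_, fun t u => ?_⟩
    · rw [if_neg]
      rintro rfl
      exact ht (hv.comp_perm w)
    · rw [Finset.mul_sum]
      refine Fintype.sum_equiv (Equiv.mulRight u⁻¹) _ _ fun w => ?_
      have key : (t ∘ u = v ∘ w) ↔ t = v ∘ (w * u⁻¹ : Equiv.Perm (Fin n)) := by
        constructor
        · intro h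
          funext i
          simpa using congrFun h (u⁻¹ i)
        · rintro rfl
          funext i
          simp
      have hs : (Equiv.Perm.sign w : ℤ) =
          (Equiv.Perm.sign u : ℤ) * (Equiv.Perm.sign (w * u⁻¹) : ℤ) := by
        rcases Int.units_eq_one_or (Equiv.Perm.sign u) with h | h <;> simp [h]
      change (if t ∘ u = v ∘ w then (Equiv.Perm.sign w : ℤ) else 0) = (Equiv.Perm.sign u : ℤ) *
        (if t = v ∘ (w * u⁻¹ : Equiv.Perm (Fin n)) then (Equiv.Perm.sign (w * u⁻¹) : ℤ) else 0)
      by_cases h : t ∘ u = v ∘ w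
      · rw [if_pos h, if_pos (key.1 h), hs]
      · rw [if_neg h, if_neg (fun h' => h (key.2 h')), mul_zero]⟩

theorem orientedSimplex_comp_perm (K : PreAbstractSimplicialComplex V) {n : ℕ} (v : Fin n → V)
    (hv : K.IsOrderedSimplex v) (w : Equiv.Perm (Fin n)) :
    K.orientedSimplex (v ∘ w) (hv.comp_perm w) =
      (Equiv.Perm.sign w : ℤ) • K.orientedSimplex v hv := by
  classical
  apply Subtype.ext
  funext t
  simp only [orientedSimplex, Submodule.coe_smul, Pi.smul_apply, smul_eq_mul]
  rw [Finset.mul_sum]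
  refine Fintype.sum_equiv (Equiv.mulLeft w) _ _ fun u => ?_
  have hs : (Equiv.Perm.sign u : ℤ) =
      (Equiv.Perm.sign w : ℤ) * (Equiv.Perm.sign (w * u) : ℤ) := by
    rcases Int.units_eq_one_or (Equiv.Perm.sign w) with h | h <;> simp [h]
  change (if t = v ∘ w ∘ u then (Equiv.Perm.sign u : ℤ) else 0) = (Equiv.Perm.sign w : ℤ) *
    (if t = v ∘ w ∘ u then (Equiv.Perm.sign (w * u) : ℤ) else 0)
  by_cases h : t = v ∘ w ∘ u
  · rw [if_pos h, if_pos h, hs]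
  · rw [if_neg h, if_neg h, mul_zero]

/-- The simplicial boundary map on oriented chains, `(∂ c)(u₀, …) = ∑ₐ c (a, u₀, …)`.
On oriented simplices this is the usual formula, see `boundary_orientedSimplex`. -/
def boundary [Fintype V] (K : PreAbstractSimplicialComplex V) (n : ℕ) :
    K.chain (n + 1) →ₗ[ℤ] K.chain n where
  toFun c := ⟨fun u => ∑ a : V, c.1 (Fin.cons a u), by
    refine ⟨fun u hu => Finset.sum_eq_zero fun a _ => c.2.1 _ fun h => hu ?_, fun u w => ?_⟩
    · have := h.comp_injective (Fin.succ_injective n)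
      simpa [Function.comp_def] using this
    · rw [Finset.mul_sum]
      refine Finset.sum_congr rfl fun a _ => ?_
      have h := c.2.2 (Fin.cons a u) (Equiv.Perm.decomposeFin.symm (0, w))
      rw [Equiv.Perm.decomposeFin.symm_sign, if_pos rfl, one_mul] at h
      rw [← h]
      refine congrArg c.1 (funext fun i => ?_)
      refine Fin.cases ?_ (fun j => ?_) i
      · simp
      · simp⟩
  map_add' c d := by
    apply Subtype.ext
    funext u
    simp [Finset.sum_add_distrib]
  map_smul' r c := by
    apply Subtype.ext
    funext u
    simp [Finset.mul_sum]

theorem boundary_orientedSimplex [Fintype V] (K : PreAbstractSimplicialComplex V) {n : ℕ}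
    (v : Fin (n + 1) → V) (hv : K.IsOrderedSimplex v) :
    K.boundary n (K.orientedSimplex v hv) =
      ∑ i : Fin (n + 1), (-1 : ℤ) ^ (i : ℕ) •
        K.orientedSimplex (v ∘ i.succAbove) (hv.comp_injective i.succAbove_right_injective) := by
  classical
  have key : ∀ {m : ℕ} (x : Fin m → V) (hx : K.IsOrderedSimplex x) (t : Fin m → V),
      (K.orientedSimplex x hx).1 t =
        (Matrix.of fun i j => if t i = x j then (1 : ℤ) else 0).det := by
    intro m x hx t
    rw [← Matrix.det_transpose, Matrix.det_apply']
    refine Finset.sum_congr rfl fun w _ => ?_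
    simp only [Matrix.transpose_apply, Matrix.of_apply, Finset.prod_ite_zero,
      Finset.prod_const_one, Finset.mem_univ, true_imp_iff, funext_iff, Function.comp_apply]
    split_ifs <;> simp
  apply Subtype.ext
  funext u
  simp only [boundary, LinearMap.coe_mk, AddHom.coe_mk, key, Submodule.coe_sum,
    Submodule.coe_smul, Finset.sum_apply, Pi.smul_apply, smul_eq_mul]
  simp only [Matrix.det_succ_row_zero]
  rw [Finset.sum_comm]
  refine Finset.sum_congr rfl fun j _ => ?_
  rw [Finset.sum_eq_single (v j)]
  · simp [Matrix.submatrix]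
  · intro a _ ha
    simp [ha]
  · simp

theorem boundary_boundary [Fintype V] (K : PreAbstractSimplicialComplex V) (n : ℕ)
    (c : K.chain (n + 2)) : K.boundary n (K.boundary (n + 1) c) = 0 := by
  apply Subtype.ext
  funext u
  have hswap : ∀ a b : V, c.1 (Fin.cons a (Fin.cons b u)) = - c.1 (Fin.cons b (Fin.cons a u)) := by
    intro a b
    have h := c.2.2 (Fin.cons b (Fin.cons a u)) (Equiv.swap 0 1)
    rw [Equiv.Perm.sign_swap (by simp)] at h
    simp only [Units.val_neg, Units.val_one, neg_mul, one_mul] at h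
    rw [← h]
    refine congrArg c.1 (funext fun i => ?_)
    refine Fin.cases (by simp) (fun j => Fin.cases (by simp) (fun k => ?_) j) i
    rw [Function.comp_apply, Equiv.swap_apply_of_ne_of_ne]
    · simp
    · exact Fin.succ_ne_zero _
    · intro h
      have := congrArg Fin.val h
      simp at this
  have hs : ∑ b : V, ∑ a : V, c.1 (Fin.cons a (Fin.cons b u)) =
      - ∑ b : V, ∑ a : V, c.1 (Fin.cons a (Fin.cons b u)) := by
    conv_lhs => rw [Finset.sum_comm]
    simp only [← Finset.sum_neg_distrib]
    exact Finset.sum_congr rfl fun b _ => Finset.sum_congr rfl fun a _ => hswap b a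
  change ∑ b : V, ∑ a : V, c.1 (Fin.cons a (Fin.cons b u)) = 0
  omega

/-- Cycles of degree `n - 1`; every chain of degree `-1` is a cycle. -/
def cycles [Fintype V] (K : PreAbstractSimplicialComplex V) : (n : ℕ) → Submodule ℤ (K.chain n)
  | 0 => ⊤
  | n + 1 => LinearMap.ker (K.boundary n)

/-- Boundaries of degree `n - 1`. -/
def boundaries [Fintype V] (K : PreAbstractSimplicialComplex V) (n : ℕ) :
    Submodule ℤ (K.chain n) :=
  LinearMap.range (K.boundary n)

theorem boundaries_le_cycles [Fintype V] (K : PreAbstractSimplicialComplex V) (n : ℕ) :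
    K.boundaries n ≤ K.cycles n := by
  rintro _ ⟨c, rfl⟩
  cases n with
  | zero => exact Submodule.mem_top
  | succ n => exact K.boundary_boundary n c

/-- Reduced simplicial homology with integer coefficients, **in degree `n - 1`**:
cycles modulo boundaries. -/
abbrev reducedHomology [Fintype V] (K : PreAbstractSimplicialComplex V) (n : ℕ) : Type _ :=
  K.cycles n ⧸ (K.boundaries n).submoduleOf (K.cycles n)

/-- The group of simplicial automorphisms of `K`. -/
def aut (K : PreAbstractSimplicialComplex V) : Subgroup (Equiv.Perm V) where
  carrier := {g | ∀ s : Finset V, s.map g.toEmbedding ∈ K ↔ s ∈ K}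
  one_mem' s := by
    have : s.map (1 : Equiv.Perm V).toEmbedding = s := Finset.map_refl
    rw [this]
  mul_mem' := by
    intro g h hg hh s
    have : s.map (g * h).toEmbedding = (s.map h.toEmbedding).map g.toEmbedding := by
      rw [Finset.map_map]; rfl
    rw [this, hg, hh]
  inv_mem' := by
    intro g hg s
    rw [← hg, Finset.map_map]
    have : s.map ((g⁻¹).toEmbedding.trans g.toEmbedding) = s := by ext; simp
    rw [this]

theorem IsOrderedSimplex.comp_aut {K : PreAbstractSimplicialComplex V} {n : ℕ} {v : Fin n → V}
    (h : K.IsOrderedSimplex v) (g : K.aut) : K.IsOrderedSimplex (g.1 ∘ v) := by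
  obtain ⟨hv, hf⟩ := h
  refine ⟨g.1.injective.comp hv, ?_⟩
  have e : Finset.univ.map ⟨g.1 ∘ v, g.1.injective.comp hv⟩ =
      (Finset.univ.map ⟨v, hv⟩).map g.1.toEmbedding := by
    rw [Finset.map_map]; rfl
  rw [e]
  rcases hf with hf | hf
  · left
    rw [hf, Finset.map_empty]
  · right
    exact (g.2 _).2 hf

/-- The action of simplicial automorphisms on oriented chains, `(g c)(v) = c (g⁻¹ v)`, that is
`g [v₀, …, vₙ₋₁] = [g v₀, …, g vₙ₋₁]`, see `chainRep_orientedSimplex`. -/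
def chainRep (K : PreAbstractSimplicialComplex V) (n : ℕ) :
    Representation ℤ K.aut (K.chain n) where
  toFun g :=
    { toFun := fun c => ⟨fun v => c.1 (⇑(g⁻¹).1 ∘ v), by
        refine ⟨fun v hv => c.2.1 _ fun h => hv ?_, fun v w => ?_⟩
        · have := h.comp_aut g
          rwa [← Function.comp_assoc, ← Equiv.Perm.coe_mul, ← Subgroup.coe_mul,
            mul_inv_cancel] at this
        · exact c.2.2 (⇑(g⁻¹).1 ∘ v) w⟩
      map_add' := fun _ _ => rfl
      map_smul' := fun _ _ => rfl }
  map_one' := by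
    ext c v
    simp
  map_mul' g h := by
    ext c v
    simp [Function.comp_assoc]

theorem chainRep_orientedSimplex (K : PreAbstractSimplicialComplex V) {n : ℕ} (g : K.aut)
    (v : Fin n → V) (hv : K.IsOrderedSimplex v) :
    K.chainRep n g (K.orientedSimplex v hv) =
      K.orientedSimplex (g.1 ∘ v) (hv.comp_aut g) := by
  classical
  apply Subtype.ext
  funext t
  refine Finset.sum_congr rfl fun w _ => ?_
  have : (⇑(g⁻¹).1 ∘ t = v ∘ w) ↔ t = (g.1 ∘ v) ∘ w := by
    constructor
    · intro h
      funext i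
      have := congrFun h i
      simp only [Function.comp_apply] at this ⊢
      rw [← this]
      simp
    · rintro rfl
      funext i
      simp
  simp only [this]

theorem boundary_chainRep [Fintype V] (K : PreAbstractSimplicialComplex V) (n : ℕ) (g : K.aut)
    (c : K.chain (n + 1)) :
    K.boundary n (K.chainRep (n + 1) g c) = K.chainRep n g (K.boundary n c) := by
  apply Subtype.ext
  funext u
  refine Fintype.sum_equiv ((g⁻¹).1) _ _ fun a => ?_
  refine congrArg c.1 (funext fun i => ?_)
  refine Fin.cases ?_ (fun j => ?_) i
  · simp
  · simp

theorem cycles_le_comap [Fintype V] (K : PreAbstractSimplicialComplex V) (n : ℕ) (g : K.aut) :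
    K.cycles n ≤ (K.cycles n).comap (K.chainRep n g) := by
  cases n with
  | zero => exact fun _ _ => Submodule.mem_top
  | succ n =>
    intro c hc
    change K.boundary n (K.chainRep (n + 1) g c) = 0
    rw [boundary_chainRep, show K.boundary n c = 0 from hc, map_zero]

/-- The action of simplicial automorphisms on cycles. -/
def cyclesRep [Fintype V] (K : PreAbstractSimplicialComplex V) (n : ℕ) :
    Representation ℤ K.aut (K.cycles n) :=
  (K.chainRep n).subrepresentation (K.cycles n) (K.cycles_le_comap n)

/-- The action of simplicial automorphisms on reduced homology in degree `n - 1`. -/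
def homologyRep [Fintype V] (K : PreAbstractSimplicialComplex V) (n : ℕ) :
    Representation ℤ K.aut (K.reducedHomology n) :=
  (K.cyclesRep n).quotient ((K.boundaries n).submoduleOf (K.cycles n)) fun g z hz => by
    obtain ⟨c, hc⟩ := hz
    refine ⟨K.chainRep (n + 1) g c, ?_⟩
    rw [boundary_chainRep, hc]
    rfl

end PreAbstractSimplicialComplex

namespace Matroid

variable {α : Type*}

/-- The automorphism group of a matroid on a finite ground set `E`: the bijections `σ : E → E`
that send independent sets to independent sets. -/
def aut (M : Matroid α) [M.Finite] : Subgroup (Equiv.Perm M.E) where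
  carrier := {σ | ∀ I : Set M.E, M.Indep (Subtype.val '' I) → M.Indep (Subtype.val '' (σ '' I))}
  one_mem' I hI := by simpa using hI
  mul_mem' := by
    intro a b ha hb I hI
    have := ha _ (hb I hI)
    rwa [← Set.image_comp a b] at this
  inv_mem' := by
    intro a ha
    have : Finite M.E := M.ground_finite
    have hpow : ∀ (k : ℕ) (I : Set M.E), M.Indep (Subtype.val '' I) →
        M.Indep (Subtype.val '' (⇑(a ^ k) '' I)) := by
      intro k
      induction k with
      | zero => intro I hI; simpa using hI
      | succ k ih =>
        intro I hI
        have := ih _ (ha I hI)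
        rwa [← Set.image_comp (⇑(a ^ k)) (⇑a)] at this
    intro I hI
    have e : a⁻¹ = a ^ (orderOf a - 1) := by
      rw [inv_eq_iff_mul_eq_one, ← pow_succ', Nat.sub_add_cancel (orderOf_pos a),
        pow_orderOf_eq_one]
    rw [e]
    exact hpow _ I hI

theorem aut_indep_iff (M : Matroid α) [M.Finite] (σ : M.aut) (I : Set M.E) :
    M.Indep (Subtype.val '' (σ.1 '' I)) ↔ M.Indep (Subtype.val '' I) := by
  refine ⟨fun h => ?_, σ.2 I⟩
  have := (σ⁻¹).2 _ h
  rwa [← Set.image_comp (⇑(σ⁻¹).1) (⇑σ.1), show ⇑(σ⁻¹).1 ∘ ⇑σ.1 = id from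
    funext fun x => σ.1.symm_apply_apply x, Set.image_id] at this

/-- The proper flats of `M`, i.e. the flats other than the ground set. -/
def ProperFlat (M : Matroid α) : Type _ := {F : Set α // M.IsFlat F ∧ F ≠ M.E}

instance (M : Matroid α) [M.Finite] : Fintype M.E := M.ground_finite.fintype

instance (M : Matroid α) [M.Finite] : Fintype M.ProperFlat :=
  ((M.ground_finite.powerset.subset fun _ hF => hF.1.subset_ground :
    {F : Set α | M.IsFlat F ∧ F ≠ M.E}.Finite)).fintype

/-- The image `σ(X) ⊆ E` of a subset `X` of the ground set under a permutation of the
ground set. -/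
def permImage (M : Matroid α) (σ : Equiv.Perm M.E) (X : Set α) : Set α :=
  Subtype.val '' (σ '' (Subtype.val ⁻¹' X))

theorem permImage_ofSubtype (M : Matroid α) (σ : Equiv.Perm M.E) [DecidablePred (· ∈ M.E)]
    {X : Set α} (hX : X ⊆ M.E) : M.permImage σ X = Equiv.Perm.ofSubtype σ '' X := by
  ext x
  simp only [permImage, Set.mem_image, Set.mem_preimage]
  constructor
  · rintro ⟨_, ⟨y, hy, rfl⟩, rfl⟩
    exact ⟨y, hy, Equiv.Perm.ofSubtype_apply_coe σ y⟩
  · rintro ⟨y, hy, rfl⟩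
    exact ⟨_, ⟨⟨y, hX hy⟩, hy, rfl⟩, (Equiv.Perm.ofSubtype_apply_coe σ ⟨y, hX hy⟩).symm⟩

theorem permImage_one (M : Matroid α) {X : Set α} (hX : X ⊆ M.E) : M.permImage 1 X = X := by
  simpa [permImage] using hX

theorem permImage_mul (M : Matroid α) (σ τ : Equiv.Perm M.E) (X : Set α) :
    M.permImage (σ * τ) X = M.permImage σ (M.permImage τ X) := by
  rw [permImage, permImage, permImage, Set.preimage_image_eq _ Subtype.val_injective,
    Equiv.Perm.coe_mul, Set.image_comp]

theorem permImage_ground (M : Matroid α) (σ : Equiv.Perm M.E) : M.permImage σ M.E = M.E := by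
  simp [permImage, Set.image_univ]

theorem permImage_subset (M : Matroid α) (σ : Equiv.Perm M.E) (X : Set α) :
    M.permImage σ X ⊆ M.E := by
  rintro _ ⟨x, _, rfl⟩
  exact x.2

theorem isFlat_permImage (M : Matroid α) [M.Finite] (σ : M.aut) {F : Set α} (hF : M.IsFlat F) :
    M.IsFlat (M.permImage σ.1 F) := by
  classical
  set f : α ≃ α := Equiv.Perm.ofSubtype σ.1 with hf
  have hE : f '' M.E = M.E := by
    rw [← M.permImage_ofSubtype σ.1 subset_rfl, permImage_ground]
  have hM : M.mapEquiv f = M := by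
    refine Matroid.ext_indep (by simp [hE]) fun I hI => ?_
    rw [mapEquiv_ground_eq, hE] at hI
    rw [mapEquiv_indep_iff]
    have hI' : f.symm '' I ⊆ M.E := by
      rw [← hE]
      rintro _ ⟨x, hx, rfl⟩
      obtain ⟨y, hy, hyx⟩ := hE.symm ▸ hI hx
      exact hE.symm ▸ (by rw [← hyx]; simpa using hy)
    have h1 := M.permImage_ofSubtype σ.1 hI'
    rw [← hf] at h1
    have h2 : f '' (f.symm '' I) = I := by simp
    rw [h2] at h1
    have h3 := M.aut_indep_iff σ (Subtype.val ⁻¹' (f.symm '' I))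
    rw [show Subtype.val '' (⇑σ.1 '' (Subtype.val ⁻¹' (f.symm '' I))) = I from h1,
      Subtype.image_preimage_coe, Set.inter_eq_self_of_subset_right hI'] at h3
    exact h3.symm
  rw [M.permImage_ofSubtype σ.1 hF.subset_ground, ← hf]
  refine ⟨fun I X hI hX => ?_, ?_⟩
  · rw [← hM, mapEquiv_isBasis_iff] at hI hX
    rw [Equiv.symm_image_image] at hI
    have := hF.subset_of_isBasis_of_isBasis hI hX
    rwa [Equiv.symm_image_subset] at this
  · rw [← hE]
    exact Set.image_mono hF.subset_ground

/-- The action `F ↦ σ(F)` of the automorphism group on the proper flats. -/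
def autOnProperFlats (M : Matroid α) [M.Finite] : M.aut →* Equiv.Perm M.ProperFlat where
  toFun σ :=
    { toFun := fun F => ⟨M.permImage σ.1 F.1, M.isFlat_permImage σ F.2.1, fun h => F.2.2 (by
        rw [← M.permImage_one F.2.1.subset_ground, ← inv_mul_cancel σ.1, permImage_mul, h,
          permImage_ground])⟩
      invFun := fun F => ⟨M.permImage (σ⁻¹).1 F.1, M.isFlat_permImage σ⁻¹ F.2.1, fun h => F.2.2 (by
        rw [← M.permImage_one F.2.1.subset_ground, ← mul_inv_cancel σ.1, permImage_mul,
          ← Subgroup.coe_inv, h, permImage_ground])⟩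
      left_inv := fun F => Subtype.ext (by
        change M.permImage _ (M.permImage _ _) = _
        rw [← permImage_mul, Subgroup.coe_inv, inv_mul_cancel,
          M.permImage_one F.2.1.subset_ground])
      right_inv := fun F => Subtype.ext (by
        change M.permImage _ (M.permImage _ _) = _
        rw [← permImage_mul, Subgroup.coe_inv, mul_inv_cancel,
          M.permImage_one F.2.1.subset_ground]) }
  map_one' := Equiv.ext fun F => Subtype.ext (M.permImage_one F.2.1.subset_ground)
  map_mul' σ τ := Equiv.ext fun F => Subtype.ext (M.permImage_mul σ.1 τ.1 F.1)

/-- The independence complex: vertices in the ground set, faces the independent sets. -/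
def indepComplex (M : Matroid α) : PreAbstractSimplicialComplex M.E where
  faces := {s | s.Nonempty ∧ M.Indep (Subtype.val '' (s : Set M.E))}
  isRelLowerSet_faces := fun _ hs =>
    ⟨hs.1, fun _ hts ht => ⟨ht, hs.2.subset (Set.image_mono hts)⟩⟩

/-- The augmented Bergman complex. Its vertices are `y_i = Sum.inl i` for `i` in the ground set and
`x_F = Sum.inr F` for the proper flats `F`; its faces are the sets `{y_i : i ∈ I} ∪ {x_F : F ∈ C}`
with `I` independent, `C` a chain of proper flats, and `I ⊆ F` for all `F ∈ C`. -/
def augBergman (M : Matroid α) : PreAbstractSimplicialComplex (M.E ⊕ M.ProperFlat) where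
  faces := {s | s.Nonempty ∧
    M.Indep (Subtype.val '' {i : M.E | Sum.inl i ∈ s}) ∧
    (∀ i F, Sum.inl i ∈ s → Sum.inr F ∈ s → i.1 ∈ F.1) ∧
    (∀ F G, Sum.inr F ∈ s → Sum.inr G ∈ s → F.1 ⊆ G.1 ∨ G.1 ⊆ F.1)}
  isRelLowerSet_faces := fun _ hs =>
    ⟨hs.1, fun _ hts ht => ⟨ht,
      hs.2.1.subset (Set.image_mono fun _ hi => hts hi),
      fun i F hi hF => hs.2.2.1 i F (hts hi) (hts hF),
      fun F G hF hG => hs.2.2.2 F G (hts hF) (hts hG)⟩⟩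

/-- The action of the automorphism group of `M` on the independence complex. -/
def autIndepComplex (M : Matroid α) [M.Finite] : M.aut →* M.indepComplex.aut :=
  M.aut.subtype.codRestrict _ fun σ s => by
    change (_ ∧ _) ↔ (_ ∧ _)
    rw [Finset.map_nonempty, Finset.coe_map]
    exact and_congr_right fun _ => M.aut_indep_iff σ s

/-- The action of the automorphism group of `M` on the augmented Bergman complex,
`y_i ↦ y_{σ(i)}` and `x_F ↦ x_{σ(F)}`. -/
def autAugBergman (M : Matroid α) [M.Finite] : M.aut →* M.augBergman.aut :=
  ((Equiv.Perm.sumCongrHom M.E M.ProperFlat).comp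
    (M.aut.subtype.prod M.autOnProperFlats)).codRestrict _ (by
      have key : ∀ (σ : M.aut) (s : Finset (M.E ⊕ M.ProperFlat)), s ∈ M.augBergman →
          s.map (Equiv.Perm.sumCongrHom M.E M.ProperFlat
            (σ.1, M.autOnProperFlats σ)).toEmbedding ∈ M.augBergman := by
        rintro σ s ⟨hne, hI, hIF, hFF⟩
        have hl : ∀ i, Sum.inl i ∈ s.map (Equiv.Perm.sumCongrHom M.E M.ProperFlat
            (σ.1, M.autOnProperFlats σ)).toEmbedding → ∃ j, Sum.inl j ∈ s ∧ σ.1 j = i := by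
          intro i hi
          obtain ⟨x, hx, hxi⟩ := Finset.mem_map.mp hi
          rcases x with j | F
          · exact ⟨j, hx, Sum.inl_injective hxi⟩
          · cases hxi
        have hr : ∀ F, Sum.inr F ∈ s.map (Equiv.Perm.sumCongrHom M.E M.ProperFlat
            (σ.1, M.autOnProperFlats σ)).toEmbedding →
            ∃ G, Sum.inr G ∈ s ∧ M.permImage σ.1 G.1 = F.1 := by
          intro F hF
          obtain ⟨x, hx, hxF⟩ := Finset.mem_map.mp hF
          rcases x with j | G
          · cases hxF
          · exact ⟨G, hx, congrArg Subtype.val (Sum.inr_injective hxF)⟩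
        refine ⟨hne.map, ((M.aut_indep_iff σ _).2 hI).subset (Set.image_mono ?_), ?_, ?_⟩
        · intro i hi
          obtain ⟨j, hj, rfl⟩ := hl i hi
          exact ⟨j, hj, rfl⟩
        · intro i F hi hF
          obtain ⟨j, hj, rfl⟩ := hl i hi
          obtain ⟨G, hG, hGF⟩ := hr F hF
          rw [← hGF]
          exact ⟨_, ⟨j, hIF j G hj hG, rfl⟩, rfl⟩
        · intro F F' hF hF'
          obtain ⟨G, hG, hGF⟩ := hr F hF
          obtain ⟨G', hG', hGF'⟩ := hr F' hF'
          rw [← hGF, ← hGF']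
          exact (hFF G G' hG hG').imp
            (fun h => Set.image_mono (Set.image_mono (Set.preimage_mono h)))
            (fun h => Set.image_mono (Set.image_mono (Set.preimage_mono h)))
      intro σ s
      refine ⟨fun h => ?_, key σ s⟩
      have := key σ⁻¹ _ h
      rw [Finset.map_map] at this
      convert this using 1
      have e : (MonoidHom.comp (Equiv.Perm.sumCongrHom M.E M.ProperFlat)
          (M.aut.subtype.prod M.autOnProperFlats)) σ⁻¹ *
          (MonoidHom.comp (Equiv.Perm.sumCongrHom M.E M.ProperFlat)
          (M.aut.subtype.prod M.autOnProperFlats)) σ = 1 := by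
        rw [← map_mul, inv_mul_cancel, map_one]
      ext x
      rw [Finset.mem_map]
      refine ⟨fun hx => ⟨x, hx, DFunLike.congr_fun e x⟩, ?_⟩
      rintro ⟨y, hy, rfl⟩
      have h2 := DFunLike.congr_fun e y
      exact (congrArg (· ∈ s) h2).mpr hy)

/-- The action of the automorphism group of `M` on the reduced homology, in degree `n - 1`,
of its augmented Bergman complex. -/
def augBergmanHomologyRep (M : Matroid α) [M.Finite] (n : ℕ) :
    Representation ℤ M.aut (M.augBergman.reducedHomology n) :=
  (M.augBergman.homologyRep n).comp M.autAugBergman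

/-- The action of the automorphism group of `M` on the oriented chain group, of degree `n - 1`,
of its independence complex. -/
def indepChainRep (M : Matroid α) [M.Finite] (n : ℕ) :
    Representation ℤ M.aut (M.indepComplex.chain n) :=
  (M.indepComplex.chainRep n).comp M.autIndepComplex

/-- The rank of a matroid on a finite ground set: the common cardinality of its bases. -/
def finRank (M : Matroid α) [M.Finite] : ℕ := M.eRank.toNat

theorem finRank_eq_ncard (M : Matroid α) [M.Finite] {B : Set α} (hB : M.IsBase B) :
    M.finRank = B.ncard := by
  rw [finRank, ← hB.encard_eq_eRank]
  rfl

end Matroid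

end

/-!
Write `r` for the rank of `M`. Since the augmented Bergman complex has no simplices with more than
`r` vertices (`le_finRank_of_isOrderedSimplex`), its homology in degree `r - 1` is the group of
top-dimensional cycles. The simplices all of whose vertices are of the form `y_i` form a copy of the
independence complex, stable under `Aut(M)`, and the isomorphism is the restriction of a cycle to
these simplices; it is visibly equivariant.

What makes it bijective is that every simplex `{y_i : i ∈ I} ∪ {x_F : F ∈ C}` with `I` not a basis
has an apex (`IsApex`): the vertex `x_F` of the flat `F` spanned by `I`. The apex can be added to
the simplex or removed from it, and the simplices with a given `I` are thereby matched in pairs.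
Algebraically, filter the chains by the number of elements of `I`; then the operator `cone`, which
adds the apex, is a contracting homotopy on each graded piece away from the bases
(`boundary_cone_apply`).

* Surjectivity (`exists_mem_cycles`): extend a chain of the independence complex by zero, and
  repeatedly subtract the cone of its boundary. This does not change the values on bases, and each
  subtraction lowers by one the largest number of `y_i` in a simplex of the boundary, until the
  boundary vanishes.
* Injectivity (`eq_zero_of_mem_cycles`): suppose that a top-dimensional cycle vanishes on the
  bases. Maximal simplices contain their apex. The boundary, evaluated at such a simplex with its
  apex removed, expresses the value at the simplex through values at simplices with one more vertex
  `y_i`, so the cycle vanishes by induction.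

The explicit basis is then the preimage of the basis of oriented simplices of the top-degree
chain group of the independence complex.
-/

noncomputable section

/-! ### Oriented chains -/

namespace PreAbstractSimplicialComplex

variable {V : Type*}

theorem chain_apply_eq_zero {K : PreAbstractSimplicialComplex V} {n : ℕ} (c : K.chain n)
    {v : Fin n → V} (hv : ¬ K.IsOrderedSimplex v) : c.1 v = 0 :=
  c.2.1 v hv

theorem chain_apply_comp_perm {K : PreAbstractSimplicialComplex V} {n : ℕ} (c : K.chain n)
    (v : Fin n → V) (w : Equiv.Perm (Fin n)) :
    c.1 (v ∘ w) = (Equiv.Perm.sign w : ℤ) * c.1 v :=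
  c.2.2 v w

theorem chain_apply_comp_perm_eq_zero {K : PreAbstractSimplicialComplex V} {n : ℕ} (c : K.chain n)
    (v : Fin n → V) (w : Equiv.Perm (Fin n)) : c.1 (v ∘ w) = 0 ↔ c.1 v = 0 := by
  rw [chain_apply_comp_perm, mul_eq_zero]
  simp

theorem chain_apply_cons_cons {K : PreAbstractSimplicialComplex V} {n : ℕ} (c : K.chain (n + 2))
    (a b : V) (u : Fin n → V) :
    c.1 (Fin.cons a (Fin.cons b u)) = - c.1 (Fin.cons b (Fin.cons a u)) := by
  have h := chain_apply_comp_perm c (Fin.cons b (Fin.cons a u)) (Equiv.swap 0 1)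
  rw [Equiv.Perm.sign_swap (by simp)] at h
  simp only [Units.val_neg, Units.val_one, neg_mul, one_mul] at h
  rw [← h]
  refine congrArg c.1 (funext fun i => ?_)
  refine Fin.cases (by simp) (fun j => Fin.cases (by simp) (fun k => ?_) j) i
  rw [Function.comp_apply, Equiv.swap_apply_of_ne_of_ne]
  · simp
  · exact Fin.succ_ne_zero _
  · intro h
    have := congrArg Fin.val h
    simp at this

theorem boundary_apply [Fintype V] (K : PreAbstractSimplicialComplex V) (n : ℕ)
    (c : K.chain (n + 1)) (u : Fin n → V) :
    (K.boundary n c).1 u = ∑ a : V, c.1 (Fin.cons a u) :=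
  rfl

/-- Any vertex of a tuple can be moved to the front by a permutation. -/
theorem exists_perm_comp_eq_cons {n : ℕ} (v : Fin (n + 1) → V) {x : V} (hx : x ∈ Set.range v) :
    ∃ (w : Equiv.Perm (Fin (n + 1))) (u : Fin n → V), v ∘ w = Fin.cons x u := by
  obtain ⟨i, rfl⟩ := hx
  refine ⟨Equiv.swap 0 i, Fin.tail (v ∘ Equiv.swap 0 i), ?_⟩
  conv_lhs => rw [← Fin.cons_self_tail (v ∘ Equiv.swap 0 i)]
  simp

/-- The signed value of a chain on the tail of a reordering of `v` depends only on which vertex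
has been moved to the front. -/
theorem sign_mul_apply_tail_congr {K : PreAbstractSimplicialComplex V} {n : ℕ} (d : K.chain n)
    (v : Fin (n + 1) → V) {w w' : Equiv.Perm (Fin (n + 1))} (h : w 0 = w' 0) :
    (Equiv.Perm.sign w : ℤ) * d.1 (v ∘ w ∘ Fin.succ) =
      (Equiv.Perm.sign w' : ℤ) * d.1 (v ∘ w' ∘ Fin.succ) := by
  obtain ⟨⟨p, q⟩, hpq⟩ := Equiv.Perm.decomposeFin.symm.surjective (w⁻¹ * w')
  have hp : p = 0 := by
    have h0 : (w⁻¹ * w') 0 = 0 := by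
      rw [Equiv.Perm.mul_apply, ← h]; simp
    rw [← hpq] at h0
    simpa using h0
  subst hp
  have hw' : w' = w * Equiv.Perm.decomposeFin.symm (0, q) := by rw [hpq]; group
  have hsign : Equiv.Perm.sign w' = Equiv.Perm.sign w * Equiv.Perm.sign q := by
    rw [hw', Equiv.Perm.sign_mul, Equiv.Perm.decomposeFin.symm_sign, if_pos rfl, one_mul]
  have hcomp : v ∘ w' ∘ Fin.succ = (v ∘ w ∘ Fin.succ) ∘ q := by
    funext i
    simp [hw']
  rw [hcomp, chain_apply_comp_perm, hsign]
  rcases Int.units_eq_one_or (Equiv.Perm.sign q) with h | h <;> simp [h]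

theorem range_comp_perm {n : ℕ} (v : Fin n → V) (w : Equiv.Perm (Fin n)) :
    Set.range (v ∘ w) = Set.range v :=
  w.surjective.range_comp v

/-- Two injective tuples with the same range differ by a permutation. -/
theorem exists_perm_eq_comp {n : ℕ} {v t : Fin n → V} (hv : Function.Injective v)
    (ht : Function.Injective t) (h : Set.range t = Set.range v) :
    ∃ w : Equiv.Perm (Fin n), t = v ∘ w := by
  refine ⟨(Equiv.ofInjective t ht).trans
    ((Equiv.setCongr h).trans (Equiv.ofInjective v hv).symm), ?_⟩
  funext i
  have := Equiv.apply_ofInjective_symm hv (Equiv.setCongr h (Equiv.ofInjective t ht i))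
  simpa using this.symm

theorem orientedSimplex_apply_self (K : PreAbstractSimplicialComplex V)
    {n : ℕ} {v : Fin n → V} (hv : K.IsOrderedSimplex v) : (K.orientedSimplex v hv).1 v = 1 := by
  refine (Finset.sum_eq_single 1 (fun w _ hw => if_neg fun h => hw ?_) (by simp)).trans (by simp)
  ext i
  exact congrArg Fin.val (hv.1 (congrFun h i)).symm

theorem orientedSimplex_apply_eq_zero (K : PreAbstractSimplicialComplex V)
    {n : ℕ} {v : Fin n → V} (hv : K.IsOrderedSimplex v) {t : Fin n → V}
    (ht : Set.range t ≠ Set.range v) : (K.orientedSimplex v hv).1 t = 0 :=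
  Finset.sum_eq_zero fun w _ => if_neg fun h => ht (by rw [h, range_comp_perm])

end PreAbstractSimplicialComplex

namespace Matroid

open PreAbstractSimplicialComplex

variable {α : Type*} {M : Matroid α}

/-! ### Simplices of the two complexes -/

theorem isOrderedSimplex_indepComplex_iff {n : ℕ} {t : Fin n → M.E} :
    M.indepComplex.IsOrderedSimplex t ↔
      Function.Injective t ∧ M.Indep (Set.range fun i => (t i : α)) := by
  have e : (Set.range fun i => (t i : α)) = Subtype.val '' Set.range t := by
    rw [← Set.range_comp]; rfl
  rw [e]
  constructor
  · rintro ⟨ht, h⟩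
    refine ⟨ht, ?_⟩
    rcases h with h | ⟨-, h⟩
    · rw [Finset.map_eq_empty] at h
      have : IsEmpty (Fin n) := Finset.univ_eq_empty_iff.mp h
      rw [Set.range_eq_empty, Set.image_empty]
      exact M.empty_indep
    · simpa using h
  · rintro ⟨ht, h⟩
    refine ⟨ht, ?_⟩
    rcases Finset.eq_empty_or_nonempty (Finset.univ.map ⟨t, ht⟩) with he | hne
    · exact Or.inl he
    · exact Or.inr ⟨hne, by simpa using h⟩

/-- The independent-set part `I` of the simplex `{y_i : i ∈ I} ∪ {x_F : F ∈ C}` listed by `v`. -/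
def indepPart {n : ℕ} (v : Fin n → M.E ⊕ M.ProperFlat) : Set α :=
  Subtype.val '' {i : M.E | Sum.inl i ∈ Set.range v}

/-- The number of entries of `v` of the form `y_i`. -/
def numElements {n : ℕ} (v : Fin n → M.E ⊕ M.ProperFlat) : ℕ :=
  (Finset.univ.filter fun k => (v k).isLeft).card

theorem isOrderedSimplex_augBergman_iff {n : ℕ} {v : Fin n → M.E ⊕ M.ProperFlat} :
    M.augBergman.IsOrderedSimplex v ↔ Function.Injective v ∧ M.Indep (indepPart v) ∧
      (∀ i F, Sum.inl i ∈ Set.range v → Sum.inr F ∈ Set.range v → i.1 ∈ F.1) ∧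
      (∀ F G, Sum.inr F ∈ Set.range v → Sum.inr G ∈ Set.range v → F.1 ⊆ G.1 ∨ G.1 ⊆ F.1) := by
  have hmem : ∀ (hv : Function.Injective v) x,
      x ∈ Finset.univ.map ⟨v, hv⟩ ↔ x ∈ Set.range v := by
    intro hv x; simp
  constructor
  · rintro ⟨hv, h⟩
    refine ⟨hv, ?_⟩
    rcases h with h | ⟨-, h⟩
    · rw [Finset.map_eq_empty] at h
      have : IsEmpty (Fin n) := Finset.univ_eq_empty_iff.mp h
      simp [indepPart]
    · rw [indepPart]
      simpa only [hmem] using h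
  · rintro ⟨hv, h⟩
    refine ⟨hv, ?_⟩
    rcases Finset.eq_empty_or_nonempty (Finset.univ.map ⟨v, hv⟩) with he | hne
    · exact Or.inl he
    · refine Or.inr ⟨hne, ?_⟩
      rw [indepPart] at h
      simpa only [hmem] using h

theorem indepPart_comp_perm {n : ℕ} (v : Fin n → M.E ⊕ M.ProperFlat) (w : Equiv.Perm (Fin n)) :
    indepPart (v ∘ w) = indepPart v := by
  rw [indepPart, range_comp_perm, indepPart]

theorem indepPart_cons_inr {n : ℕ} (F : M.ProperFlat) (u : Fin n → M.E ⊕ M.ProperFlat) :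
    indepPart (Fin.cons (Sum.inr F) u : Fin (n + 1) → M.E ⊕ M.ProperFlat) = indepPart u := by
  simp [indepPart, Fin.range_cons]

theorem numElements_comp_perm {n : ℕ} (v : Fin n → M.E ⊕ M.ProperFlat)
    (w : Equiv.Perm (Fin n)) : numElements (v ∘ w) = numElements v :=
  Finset.card_equiv w fun i => by simp

theorem numElements_cons_inl {n : ℕ} (i : M.E) (u : Fin n → M.E ⊕ M.ProperFlat) :
    numElements (Fin.cons (Sum.inl i) u : Fin (n + 1) → M.E ⊕ M.ProperFlat) =
      numElements u + 1 := by
  simp [numElements, Fin.card_filter_univ_succ]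

theorem numElements_cons_inr {n : ℕ} (F : M.ProperFlat) (u : Fin n → M.E ⊕ M.ProperFlat) :
    numElements (Fin.cons (Sum.inr F) u : Fin (n + 1) → M.E ⊕ M.ProperFlat) = numElements u := by
  simp [numElements, Fin.card_filter_univ_succ]

theorem numElements_le {n : ℕ} (v : Fin n → M.E ⊕ M.ProperFlat) : numElements v ≤ n :=
  (Finset.card_le_univ _).trans_eq (Fintype.card_fin n)

theorem exists_eq_inl_comp {n : ℕ} {v : Fin n → M.E ⊕ M.ProperFlat} (h : n ≤ numElements v) :
    ∃ t : Fin n → M.E, v = Sum.inl ∘ t := by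
  have h1 : (Finset.univ.filter fun k => (v k).isLeft) = Finset.univ :=
    Finset.eq_univ_of_card _ (((numElements_le v).antisymm h).trans (Fintype.card_fin n).symm)
  have h2 : ∀ k, ∃ i, v k = Sum.inl i := fun k =>
    Sum.isLeft_iff.mp (by simpa using Finset.ext_iff.mp h1 k)
  choose t ht using h2
  exact ⟨t, funext ht⟩

theorem encard_indepPart {n : ℕ} {v : Fin n → M.E ⊕ M.ProperFlat} (hv : Function.Injective v) :
    (indepPart v).encard = numElements v := by
  have e : Sum.inl '' {i : M.E | Sum.inl i ∈ Set.range v} =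
      v '' ((Finset.univ.filter fun k => (v k).isLeft : Finset (Fin n)) : Set (Fin n)) := by
    ext x
    simp only [Set.mem_image, Set.mem_ofPred_eq, Set.mem_range, Finset.coe_filter,
      Finset.mem_univ, true_and]
    constructor
    · rintro ⟨i, ⟨k, hk⟩, rfl⟩
      exact ⟨k, by simp [hk], hk⟩
    · rintro ⟨k, hk, rfl⟩
      obtain ⟨i, hi⟩ := Sum.isLeft_iff.mp hk
      exact ⟨i, ⟨k, hi⟩, hi.symm⟩
  rw [indepPart, Subtype.val_injective.encard_image,
    ← (Sum.inl_injective (β := M.ProperFlat)).encard_image, e, hv.encard_image,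
    Set.encard_coe_eq_coe_finsetCard, numElements]

/-! ### Apexes and the dimension of the complex -/

/-- The vertex `x` is the *apex* of the simplex `{y_i : i ∈ I} ∪ {x_F : F ∈ C}` listed by `v` if
`x = x_F` for the flat `F` spanned by `I`; the apex exists as soon as `I` is not spanning, and
need not itself be a vertex of the simplex. -/
def IsApex {n : ℕ} (v : Fin n → M.E ⊕ M.ProperFlat) (x : M.E ⊕ M.ProperFlat) : Prop :=
  ∃ F : M.ProperFlat, x = Sum.inr F ∧ F.1 = M.closure (indepPart v)

theorem IsApex.unique {n : ℕ} {v : Fin n → M.E ⊕ M.ProperFlat} {x y : M.E ⊕ M.ProperFlat}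
    (hx : IsApex v x) (hy : IsApex v y) : x = y := by
  obtain ⟨F, rfl, hF⟩ := hx
  obtain ⟨G, rfl, hG⟩ := hy
  exact congrArg Sum.inr (Subtype.ext (hF.trans hG.symm))

theorem isApex_comp_perm {n : ℕ} {v : Fin n → M.E ⊕ M.ProperFlat} (w : Equiv.Perm (Fin n))
    {x : M.E ⊕ M.ProperFlat} : IsApex (v ∘ w) x ↔ IsApex v x := by
  rw [IsApex, IsApex, indepPart_comp_perm]

theorem isApex_cons_inr {n : ℕ} (F : M.ProperFlat) {u : Fin n → M.E ⊕ M.ProperFlat}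
    {x : M.E ⊕ M.ProperFlat} :
    IsApex (Fin.cons (Sum.inr F) u : Fin (n + 1) → M.E ⊕ M.ProperFlat) x ↔ IsApex u x := by
  rw [IsApex, IsApex, indepPart_cons_inr]

theorem coe_finRank (M : Matroid α) [M.Finite] : (M.finRank : ℕ∞) = M.eRank :=
  ENat.natCast_toNat ((eRank_ne_top_iff M).2 inferInstance)

theorem exists_isApex [M.Finite] {n : ℕ} {v : Fin n → M.E ⊕ M.ProperFlat}
    (hv : M.augBergman.IsOrderedSimplex v) (h : numElements v < M.finRank) :
    ∃ x, IsApex v x := by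
  obtain ⟨hinj, hI, -, -⟩ := isOrderedSimplex_augBergman_iff.mp hv
  refine ⟨Sum.inr ⟨M.closure (indepPart v), M.isFlat_closure _, fun hE => ?_⟩, _, rfl, rfl⟩
  have h1 : M.eRk (indepPart v) = M.eRank := by
    rw [← M.eRk_closure_eq, hE, eRk_ground]
  rw [hI.eRk_eq_encard, encard_indepPart hinj, ← coe_finRank] at h1
  exact h.ne (by exact_mod_cast h1)

/-- Adjoining the apex to a simplex yields a simplex. -/
theorem IsApex.isOrderedSimplex_cons {n : ℕ} {u : Fin n → M.E ⊕ M.ProperFlat}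
    {x : M.E ⊕ M.ProperFlat} (hx : IsApex u x) (hu : M.augBergman.IsOrderedSimplex u)
    (hxu : x ∉ Set.range u) : M.augBergman.IsOrderedSimplex (Fin.cons x u) := by
  obtain ⟨F, rfl, hF⟩ := hx
  obtain ⟨hinj, hI, hIF, hFF⟩ := isOrderedSimplex_augBergman_iff.mp hu
  have hmin : ∀ G, Sum.inr G ∈ Set.range u → F.1 ⊆ G.1 := by
    intro G hG
    rw [hF, ← G.2.1.closure]
    refine M.closure_subset_closure ?_
    rintro _ ⟨i, hi, rfl⟩
    exact hIF i G hi hG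
  refine isOrderedSimplex_augBergman_iff.mpr
    ⟨Fin.cons_injective_iff.mpr ⟨hxu, hinj⟩, by rwa [indepPart_cons_inr], ?_, ?_⟩
  · rw [Fin.range_cons]
    rintro i G (hi | hi) hG
    · cases hi
    · rcases hG with hG | hG
      · obtain rfl := Sum.inr_injective hG
        rw [hF]
        exact M.subset_closure (indepPart u) hI.subset_ground ⟨i, hi, rfl⟩
      · exact hIF i G hi hG
  · rw [Fin.range_cons]
    rintro G H (hG | hG) (hH | hH)
    · obtain rfl := Sum.inr_injective hG
      obtain rfl := Sum.inr_injective hH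
      exact Or.inl subset_rfl
    · obtain rfl := Sum.inr_injective hG
      exact Or.inl (hmin H hH)
    · obtain rfl := Sum.inr_injective hH
      exact Or.inr (hmin G hG)
    · exact hFF G H hG hH

/-- A simplex of the augmented Bergman complex has at most `r` vertices: with `k` vertices `y_i`,
the flats occurring in it are determined by their ranks, which lie in `[k, r)`. -/
theorem le_finRank_of_isOrderedSimplex [M.Finite] {n : ℕ} {v : Fin n → M.E ⊕ M.ProperFlat}
    (hv : M.augBergman.IsOrderedSimplex v) : n ≤ M.finRank := by
  obtain ⟨hinj, hI, hIF, hFF⟩ := isOrderedSimplex_augBergman_iff.mp hv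
  have hk : numElements v ≤ M.finRank := by
    have := hI.encard_le_eRank
    rw [encard_indepPart hinj, ← coe_finRank] at this
    exact_mod_cast this
  let f : Fin n → ℕ := fun k => (v k).elim (fun _ => 0) fun F => (M.eRk F.1).toNat
  have hcoe : ∀ F : Set α, ((M.eRk F).toNat : ℕ∞) = M.eRk F := fun F =>
    ENat.natCast_toNat (eRk_ne_top_iff.2 (M.isRkFinite_set F))
  have hcard : (Finset.univ.filter fun k => ¬ (v k).isLeft).card ≤
      (Finset.Ico (numElements v) M.finRank).card := by
    have hright : ∀ {k}, k ∈ Finset.univ.filter (fun k => ¬ (v k).isLeft) →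
        ∃ F, v k = Sum.inr F := by
      intro k hk
      simpa [Sum.isRight_iff] using hk
    refine Finset.card_le_card_of_injOn f ?_ ?_
    · intro k hk
      obtain ⟨F, hF⟩ := hright (Finset.mem_coe.mp hk)
      have hfk : f k = (M.eRk F.1).toNat := by simp [f, hF]
      rw [Finset.coe_Ico, Set.mem_Ico, hfk]
      constructor
      · rw [← Nat.cast_le (α := ℕ∞), hcoe, ← encard_indepPart hinj]
        refine hI.encard_le_eRk_of_subset ?_
        rintro _ ⟨i, hi, rfl⟩
        exact hIF i F hi ⟨k, hF⟩
      · rw [← Nat.cast_lt (α := ℕ∞), hcoe, coe_finRank]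
        refine lt_of_le_of_ne (M.eRk_le_eRank _) fun he => F.2.2 ?_
        have := (M.isRkFinite_set F.1).closure_eq_closure_of_subset_of_eRk_ge_eRk
          F.2.1.subset_ground (by rw [he, eRk_ground])
        rwa [F.2.1.closure, closure_ground] at this
    · intro k hk l hl hkl
      obtain ⟨F, hF⟩ := hright (Finset.mem_coe.mp hk)
      obtain ⟨G, hG⟩ := hright (Finset.mem_coe.mp hl)
      have hrk : M.eRk F.1 = M.eRk G.1 := by
        rw [← hcoe F.1, ← hcoe G.1]
        simpa [f, hF, hG] using hkl
      have hFG : F.1 = G.1 := by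
        rcases hFF F G ⟨k, hF⟩ ⟨l, hG⟩ with h | h
        · have := (M.isRkFinite_set F.1).closure_eq_closure_of_subset_of_eRk_ge_eRk h hrk.ge
          rwa [F.2.1.closure, G.2.1.closure] at this
        · have := (M.isRkFinite_set G.1).closure_eq_closure_of_subset_of_eRk_ge_eRk h hrk.le
          rw [F.2.1.closure, G.2.1.closure] at this
          exact this.symm
      exact hinj (hF.trans ((congrArg Sum.inr (Subtype.ext hFG)).trans hG.symm))
  have hsum := Finset.card_filter_add_card_filter_not (s := (Finset.univ : Finset (Fin n)))
    (fun k => (v k).isLeft = true)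
  rw [Finset.card_univ, Fintype.card_fin] at hsum
  rw [Nat.card_Ico] at hcard
  unfold numElements at hk hcard
  omega

/-! ### Coning towards the apexes -/

open Classical in
/-- The cone of a chain `d` towards the apexes: it sends `[v]` to `[x, v]` if the apex `x` of `v`
is not a vertex of `v`. As a function on tuples, its value at a simplex `v` containing its apex is,
up to the sign of the reordering that moves the apex to the front, the value of `d` at the
remaining vertices; it vanishes at all other tuples. -/
def cone {n : ℕ} (d : M.augBergman.chain n) : M.augBergman.chain (n + 1) :=
  ⟨fun v => if h : M.augBergman.IsOrderedSimplex v ∧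
      ∃ w : Equiv.Perm (Fin (n + 1)), IsApex v (v (w 0)) then
      (Equiv.Perm.sign h.2.choose : ℤ) * d.1 (v ∘ h.2.choose ∘ Fin.succ) else 0, by
    refine ⟨fun v hv => dif_neg fun h => hv h.1, fun v u => ?_⟩
    have key : ∀ v (u : Equiv.Perm (Fin (n + 1))), (M.augBergman.IsOrderedSimplex v ∧
        ∃ w : Equiv.Perm (Fin (n + 1)), IsApex v (v (w 0))) →
        M.augBergman.IsOrderedSimplex (v ∘ u) ∧
        ∃ w : Equiv.Perm (Fin (n + 1)), IsApex (v ∘ u) ((v ∘ u) (w 0)) := by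
      rintro v u ⟨hv, w, hw⟩
      exact ⟨hv.comp_perm u, u⁻¹ * w, by simpa [isApex_comp_perm] using hw⟩
    by_cases h : M.augBergman.IsOrderedSimplex v ∧
        ∃ w : Equiv.Perm (Fin (n + 1)), IsApex v (v (w 0))
    · have h' := key v u h
      beta_reduce
      rw [dif_pos h, dif_pos h']
      have h0 : (u * h'.2.choose) 0 = h.2.choose 0 :=
        h.1.1 (((isApex_comp_perm u).mp h'.2.choose_spec).unique h.2.choose_spec)
      have := sign_mul_apply_tail_congr d v h0
      rw [← this, Equiv.Perm.sign_mul, Equiv.Perm.coe_mul]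
      simp only [Function.comp_assoc]
      rcases Int.units_eq_one_or (Equiv.Perm.sign u) with hu | hu <;> simp [hu]
    · have h' : ¬ (M.augBergman.IsOrderedSimplex (v ∘ u) ∧
          ∃ w : Equiv.Perm (Fin (n + 1)), IsApex (v ∘ u) ((v ∘ u) (w 0))) := by
        intro h'
        have := key _ u⁻¹ h'
        rw [Function.comp_assoc, ← Equiv.Perm.coe_mul, mul_inv_cancel] at this
        exact h this
      beta_reduce
      rw [dif_neg h, dif_neg h', mul_zero]⟩

theorem cone_apply_cons {n : ℕ} (d : M.augBergman.chain n) {x : M.E ⊕ M.ProperFlat}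
    {u : Fin n → M.E ⊕ M.ProperFlat} (hx : IsApex u x)
    (h : M.augBergman.IsOrderedSimplex (Fin.cons x u)) :
    (cone d).1 (Fin.cons x u) = d.1 u := by
  have hx' : IsApex (Fin.cons x u : Fin (n + 1) → M.E ⊕ M.ProperFlat) x := by
    obtain ⟨F, rfl, hF⟩ := hx
    exact (isApex_cons_inr F).mpr ⟨F, rfl, hF⟩
  have h' : M.augBergman.IsOrderedSimplex (Fin.cons x u) ∧ ∃ w : Equiv.Perm (Fin (n + 1)),
      IsApex (Fin.cons x u : Fin (n + 1) → M.E ⊕ M.ProperFlat)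
        ((Fin.cons x u : Fin (n + 1) → M.E ⊕ M.ProperFlat) (w 0)) :=
    ⟨h, 1, by simpa using hx'⟩
  have h0 : h'.2.choose 0 = (1 : Equiv.Perm (Fin (n + 1))) 0 :=
    h.1 (h'.2.choose_spec.unique (by simpa using hx'))
  have := sign_mul_apply_tail_congr d (Fin.cons x u) h0
  refine (dif_pos h').trans (this.trans ?_)
  simp only [Equiv.Perm.sign_one, Units.val_one, one_mul, Equiv.Perm.coe_one]
  rfl

/-- A tuple at which a cone does not vanish contains its apex. -/
theorem exists_isApex_of_cone_apply_ne_zero {n : ℕ} {d : M.augBergman.chain n}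
    {v : Fin (n + 1) → M.E ⊕ M.ProperFlat} (h : (cone d).1 v ≠ 0) :
    ∃ x ∈ Set.range v, IsApex v x := by
  by_contra hne
  refine h (dif_neg ?_)
  rintro ⟨-, w, hw⟩
  exact hne ⟨_, ⟨_, rfl⟩, hw⟩

theorem cone_apply_inl_comp {n : ℕ} (d : M.augBergman.chain n) (t : Fin (n + 1) → M.E) :
    (cone d).1 (Sum.inl ∘ t) = 0 := by
  by_contra h
  obtain ⟨_, ⟨k, rfl⟩, F, hF, -⟩ := exists_isApex_of_cone_apply_ne_zero h
  cases hF

/-- Coning does not change the vertices `y_i` involved. -/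
theorem cone_apply_eq_zero_of_lt_numElements {n k : ℕ} {d : M.augBergman.chain n}
    (hd : ∀ u, k < numElements u → d.1 u = 0) {v : Fin (n + 1) → M.E ⊕ M.ProperFlat}
    (hv : k < numElements v) : (cone d).1 v = 0 := by
  by_contra h
  obtain ⟨x, hxv, hx⟩ := exists_isApex_of_cone_apply_ne_zero h
  obtain ⟨w, u, hw⟩ := exists_perm_comp_eq_cons v hxv
  have hs : M.augBergman.IsOrderedSimplex v := by
    by_contra hs
    exact h (chain_apply_eq_zero _ hs)
  have hs' := hs.comp_perm w
  rw [← chain_apply_comp_perm_eq_zero _ v w, hw] at h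
  rw [← isApex_comp_perm w, hw] at hx
  rw [← numElements_comp_perm v w, hw] at hv
  rw [hw] at hs'
  obtain ⟨F, rfl, hF⟩ := hx
  have hx' : IsApex u (Sum.inr F) := (isApex_cons_inr F).mp ⟨F, rfl, hF⟩
  rw [cone_apply_cons d hx' hs'] at h
  rw [numElements_cons_inr] at hv
  exact h (hd u hv)

/-- On the simplices with exactly `k` vertices `y_i`, coning is a contracting homotopy modulo
simplices with more than `k` such vertices. Here this is stated for a cycle vanishing on the
latter. -/
theorem boundary_cone_apply [M.Finite] {n k : ℕ} (hn : n < M.finRank)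
    {d : M.augBergman.chain n} (hcyc : d ∈ M.augBergman.cycles n)
    (hd : ∀ u, k < numElements u → d.1 u = 0) {u : Fin n → M.E ⊕ M.ProperFlat}
    (hu : k ≤ numElements u) : (M.augBergman.boundary n (cone d)).1 u = d.1 u := by
  classical
  by_cases hs : M.augBergman.IsOrderedSimplex u
  swap
  · rw [chain_apply_eq_zero _ hs, chain_apply_eq_zero _ hs]
  obtain ⟨x, hx⟩ := exists_isApex hs ((numElements_le u).trans_lt hn)
  have hinl : ∀ {m : ℕ} {d : M.augBergman.chain m} {u : Fin m → M.E ⊕ M.ProperFlat},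
      (∀ u, k < numElements u → d.1 u = 0) → k ≤ numElements u →
      ∀ i : M.E, (cone d).1 (Fin.cons (Sum.inl i) u) = 0 := fun hd hu i =>
    cone_apply_eq_zero_of_lt_numElements hd (by rw [numElements_cons_inl]; omega)
  by_cases hxu : x ∈ Set.range u
  -- If `u = (x, u')`, then `∂(cone d)(x, u')` and `-∑ d(a, u')`, over the flats `a ≠ x`, agree
  -- term by term, and the latter is `d(x, u')` because `d` is a cycle.
  · obtain ⟨n, rfl⟩ : ∃ m, n = m + 1 := by
      obtain ⟨i, -⟩ := hxu
      exact ⟨n - 1, by have := i.2; omega⟩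
    obtain ⟨w, u', hw⟩ := exists_perm_comp_eq_cons u hxu
    suffices h : (M.augBergman.boundary (n + 1) (cone d)).1 (u ∘ w) = d.1 (u ∘ w) by
      rw [chain_apply_comp_perm, chain_apply_comp_perm] at h
      exact mul_left_cancel₀ (by simp) h
    have hs' := hs.comp_perm w
    rw [← isApex_comp_perm w] at hx
    rw [← numElements_comp_perm u w] at hu
    rw [hw] at hs' hx hu ⊢
    obtain ⟨F, rfl, hF⟩ := hx
    have hx' : IsApex u' (Sum.inr F) := (isApex_cons_inr F).mp ⟨F, rfl, hF⟩
    have hFu' : Sum.inr F ∉ Set.range u' := (Fin.cons_injective_iff.mp hs'.1).1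
    have hbd : ∑ a, d.1 (Fin.cons a u') = 0 :=
      congrFun (congrArg Subtype.val (show M.augBergman.boundary n d = 0 from hcyc)) u'
    rw [numElements_cons_inr] at hu
    rw [boundary_apply, Fintype.sum_sum_type, Finset.sum_eq_zero fun i _ =>
      hinl hd (by rwa [numElements_cons_inr]) i, zero_add]
    rw [Fintype.sum_sum_type, Finset.sum_eq_zero fun i _ =>
      hd _ (by rw [numElements_cons_inl]; omega), zero_add,
      ← Finset.add_sum_erase _ _ (Finset.mem_univ F)] at hbd
    rw [← Finset.add_sum_erase _ _ (Finset.mem_univ F)]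
    have hFF : (cone d).1 (Fin.cons (Sum.inr F) (Fin.cons (Sum.inr F) u')) = 0 :=
      chain_apply_eq_zero _ fun h => (Fin.cons_injective_iff.mp h.1).1 ⟨0, rfl⟩
    have hG : ∀ G ∈ Finset.univ.erase F,
        (cone d).1 (Fin.cons (Sum.inr G) (Fin.cons (Sum.inr F) u')) =
          - d.1 (Fin.cons (Sum.inr G) u') := by
      intro G hG
      have hGF : G ≠ F := Finset.ne_of_mem_erase hG
      rw [chain_apply_cons_cons, neg_inj]
      have hxG : IsApex (Fin.cons (Sum.inr G) u' : Fin (n + 1) → M.E ⊕ M.ProperFlat)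
          (Sum.inr F) := (isApex_cons_inr G).mpr hx'
      by_cases hsG : M.augBergman.IsOrderedSimplex (Fin.cons (Sum.inr G) u')
      · refine cone_apply_cons d hxG (hxG.isOrderedSimplex_cons hsG ?_)
        rw [Fin.range_cons]
        rintro (h | h)
        · exact hGF (Sum.inr_injective h).symm
        · exact hFu' h
      · rw [chain_apply_eq_zero d hsG]
        refine chain_apply_eq_zero _ fun h => hsG ?_
        have := h.comp_injective (Fin.succ_injective _)
        simpa [Function.comp_def] using this
    rw [hFF, zero_add, Finset.sum_congr rfl hG, Finset.sum_neg_distrib]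
    linarith
  -- If `u` does not contain its apex `x`, then `(x, u)` is the only contribution to the boundary.
  · have hxs := hx.isOrderedSimplex_cons hs hxu
    obtain ⟨F, rfl, hF⟩ := id hx
    rw [boundary_apply, Fintype.sum_sum_type, Finset.sum_eq_zero fun i _ => hinl hd hu i,
      zero_add, Finset.sum_eq_single F, cone_apply_cons d hx hxs]
    · intro G _ hGF
      by_contra h
      obtain ⟨y, hyr, hy⟩ := exists_isApex_of_cone_apply_ne_zero h
      obtain rfl := ((isApex_cons_inr G).mp hy).unique hx
      rw [Fin.range_cons] at hyr
      rcases hyr with h | h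
      · exact hGF (Sum.inr_injective h).symm
      · exact hxu h
    · simp

/-! ### Top-dimensional cycles -/

/-- A top-dimensional cycle is determined by its values on the bases of the matroid. -/
theorem eq_zero_of_mem_cycles [M.Finite] {z : M.augBergman.chain M.finRank}
    (hz : z ∈ M.augBergman.cycles M.finRank)
    (h : ∀ t : Fin M.finRank → M.E, z.1 (Sum.inl ∘ t) = 0) : z = 0 := by
  -- Induction on `j`, the number of flats allowed in the simplex.
  suffices key : ∀ (j : ℕ) (v : Fin M.finRank → M.E ⊕ M.ProperFlat),
      M.finRank ≤ numElements v + j → z.1 v = 0 from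
    Subtype.ext (funext fun v => key M.finRank v (Nat.le_add_left _ _))
  generalize hr : M.finRank = r at z
  intro j
  induction j with
  | zero =>
    intro v hv
    obtain ⟨t, rfl⟩ := exists_eq_inl_comp hv
    exact h t
  | succ j ih =>
    intro v hv
    by_cases hlt : r ≤ numElements v + j
    · exact ih v hlt
    by_contra hne
    have hs : M.augBergman.IsOrderedSimplex v := by
      by_contra hs
      exact hne (chain_apply_eq_zero _ hs)
    -- A simplex with `r` vertices contains its apex, since it cannot be enlarged.
    have hmem : ∀ {v : Fin r → M.E ⊕ M.ProperFlat} {x}, M.augBergman.IsOrderedSimplex v →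
        IsApex v x → x ∈ Set.range v := by
      intro v x hv hx
      by_contra hxv
      have := le_finRank_of_isOrderedSimplex (hx.isOrderedSimplex_cons hv hxv)
      omega
    obtain ⟨x, hx⟩ := exists_isApex hs (by omega)
    obtain ⟨n, rfl⟩ : ∃ m, r = m + 1 := ⟨r - 1, by omega⟩
    obtain ⟨w, u, hw⟩ := exists_perm_comp_eq_cons v (hmem hs hx)
    have hs' := hs.comp_perm w
    rw [← isApex_comp_perm w] at hx
    rw [← numElements_comp_perm v w] at hv hlt
    rw [← chain_apply_comp_perm_eq_zero _ v w] at hne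
    rw [hw] at hs' hx hv hlt hne
    obtain ⟨F, rfl, hF⟩ := hx
    have hx' : IsApex u (Sum.inr F) := (isApex_cons_inr F).mp ⟨F, rfl, hF⟩
    rw [numElements_cons_inr] at hv hlt
    have hbd : ∑ a, z.1 (Fin.cons a u) = 0 :=
      congrFun (congrArg Subtype.val (show M.augBergman.boundary n z = 0 from hz)) u
    rw [Fintype.sum_sum_type, Finset.sum_eq_zero fun i _ =>
      ih _ (by rw [numElements_cons_inl]; omega), zero_add, Finset.sum_eq_single F] at hbd
    · exact hne hbd
    · intro G _ hGF
      refine chain_apply_eq_zero _ fun hsG => ?_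
      have := hmem hsG ((isApex_cons_inr G).mpr hx')
      rw [Fin.range_cons] at this
      rcases this with h | h
      · exact hGF (Sum.inr_injective h).symm
      · exact (Fin.cons_injective_iff.mp hs'.1).1 h
    · simp

/-- A chain of dimension `r - 1` can be corrected, away from the bases of the matroid, to
a cycle. -/
theorem exists_mem_cycles [M.Finite] (c : M.augBergman.chain M.finRank) :
    ∃ z ∈ M.augBergman.cycles M.finRank,
      ∀ t : Fin M.finRank → M.E, z.1 (Sum.inl ∘ t) = c.1 (Sum.inl ∘ t) := by
  generalize hr : M.finRank = r at c
  cases r with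
  | zero => exact ⟨c, Submodule.mem_top, fun _ => rfl⟩
  | succ n =>
    -- After `j` corrections the boundary lives on simplices with at most `n - j` vertices `y_i`.
    suffices key : ∀ j : ℕ, ∃ z : M.augBergman.chain (n + 1),
        (∀ t : Fin (n + 1) → M.E, z.1 (Sum.inl ∘ t) = c.1 (Sum.inl ∘ t)) ∧
        ∀ u, n < numElements u + j → (M.augBergman.boundary n z).1 u = 0 by
      obtain ⟨z, hz, hbd⟩ := key (n + 1)
      exact ⟨z, Subtype.ext (funext fun u => hbd u (by omega)), hz⟩
    intro j
    induction j with
    | zero =>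
      exact ⟨c, fun _ => rfl, fun u hu => absurd (numElements_le u) (by omega)⟩
    | succ j ih =>
      obtain ⟨z, hz, hbd⟩ := ih
      by_cases hj : n < j
      · exact ⟨z, hz, fun u _ => hbd u (by omega)⟩
      refine ⟨z - cone (M.augBergman.boundary n z), fun t => ?_, fun u hu => ?_⟩
      · change z.1 _ - (cone _).1 _ = _
        rw [cone_apply_inl_comp, sub_zero, hz]
      · rw [map_sub]
        change (M.augBergman.boundary n z).1 u - (M.augBergman.boundary n (cone _)).1 u = 0
        rw [boundary_cone_apply (k := n - j) (by omega)
          (M.augBergman.boundaries_le_cycles n ⟨z, rfl⟩) (fun u hu => hbd u (by omega))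
          (by omega), sub_self]

/-! ### Restriction to the independence complex -/

theorem isOrderedSimplex_inl_comp_iff {n : ℕ} {t : Fin n → M.E} :
    M.augBergman.IsOrderedSimplex (Sum.inl ∘ t) ↔ M.indepComplex.IsOrderedSimplex t := by
  have e : indepPart (Sum.inl ∘ t) = Set.range fun i => (t i : α) := by
    ext x
    simp [indepPart]
  rw [isOrderedSimplex_augBergman_iff, isOrderedSimplex_indepComplex_iff, e,
    Sum.inl_injective.of_comp_iff]
  simp

/-- Restriction of chains from the augmented Bergman complex to the independence complex, which is
its full subcomplex on the vertices `y_i`. -/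
def restrictChain (M : Matroid α) (n : ℕ) : M.augBergman.chain n →ₗ[ℤ] M.indepComplex.chain n where
  toFun c := ⟨fun t => c.1 (Sum.inl ∘ t),
    fun _ ht => chain_apply_eq_zero c fun h => ht (isOrderedSimplex_inl_comp_iff.mp h),
    fun t w => chain_apply_comp_perm c (Sum.inl ∘ t) w⟩
  map_add' _ _ := rfl
  map_smul' _ _ := rfl

theorem restrictChain_surjective (M : Matroid α) (n : ℕ) :
    Function.Surjective (M.restrictChain n) := by
  classical
  intro c
  have key : ∀ (v : Fin n → M.E ⊕ M.ProperFlat) (w : Equiv.Perm (Fin n)),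
      (∃ t : Fin n → M.E, v = Sum.inl ∘ t) → ∃ t : Fin n → M.E, v ∘ w = Sum.inl ∘ t := by
    rintro _ w ⟨t, rfl⟩
    exact ⟨t ∘ w, rfl⟩
  have hval : ∀ (t : Fin n → M.E) (h : ∃ t' : Fin n → M.E,
      (Sum.inl ∘ t : Fin n → M.E ⊕ M.ProperFlat) = Sum.inl ∘ t'), h.choose = t := fun t h =>
    (Sum.inl_injective.comp_left h.choose_spec).symm
  refine ⟨⟨fun v => if h : ∃ t : Fin n → M.E, v = Sum.inl ∘ t then c.1 h.choose else 0,
    fun v hv => ?_, fun v w => ?_⟩, ?_⟩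
  · beta_reduce
    split_ifs with h
    · refine chain_apply_eq_zero c fun hs => hv ?_
      rw [h.choose_spec]
      exact isOrderedSimplex_inl_comp_iff.mpr hs
    · rfl
  · beta_reduce
    by_cases h : ∃ t : Fin n → M.E, v = Sum.inl ∘ t
    · obtain ⟨t, rfl⟩ := h
      rw [dif_pos (key _ w ⟨t, rfl⟩), dif_pos ⟨t, rfl⟩, hval t ⟨t, rfl⟩]
      have := hval (t ∘ w) (key _ w ⟨t, rfl⟩)
      exact (congrArg c.1 this).trans (chain_apply_comp_perm c t w)
    · rw [dif_neg h, dif_neg, mul_zero]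
      intro h'
      have := key _ w⁻¹ h'
      rw [Function.comp_assoc, ← Equiv.Perm.coe_mul, mul_inv_cancel] at this
      exact h this
  · apply Subtype.ext
    funext t
    exact (dif_pos ⟨t, rfl⟩).trans (congrArg c.1 (hval t ⟨t, rfl⟩))

theorem restrictChain_chainRep [M.Finite] (n : ℕ) (g : M.aut) (c : M.augBergman.chain n) :
    M.restrictChain n (M.augBergman.chainRep n (M.autAugBergman g) c) =
      M.indepComplex.chainRep n (M.autIndepComplex g) (M.restrictChain n c) :=
  rfl

theorem boundaries_augBergman_finRank (M : Matroid α) [M.Finite] :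
    M.augBergman.boundaries M.finRank = ⊥ := by
  rw [boundaries, LinearMap.range_eq_bot]
  refine LinearMap.ext fun c => ?_
  have : c = 0 := Subtype.ext (funext fun v => chain_apply_eq_zero c fun hv =>
    absurd (le_finRank_of_isOrderedSimplex hv) (by omega))
  rw [this, map_zero, map_zero]

/-- Restriction to the independence complex, on top-degree homology. It is well defined because
there are no nonzero top-degree boundaries. -/
def restrictHomology (M : Matroid α) [M.Finite] :
    M.augBergman.reducedHomology M.finRank →ₗ[ℤ] M.indepComplex.chain M.finRank :=
  Submodule.liftQ _ ((M.restrictChain M.finRank).comp (M.augBergman.cycles M.finRank).subtype) (by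
    rw [boundaries_augBergman_finRank]
    rintro z (hz : z.1 = 0)
    simp [hz])

theorem restrictHomology_mk (M : Matroid α) [M.Finite] (z : M.augBergman.cycles M.finRank) :
    M.restrictHomology (Submodule.Quotient.mk z) = M.restrictChain M.finRank z.1 :=
  rfl

theorem restrictHomology_bijective (M : Matroid α) [M.Finite] :
    Function.Bijective M.restrictHomology := by
  constructor
  · rw [injective_iff_map_eq_zero]
    intro x hx
    obtain ⟨z, rfl⟩ := Submodule.Quotient.mk_surjective _ x
    rw [restrictHomology_mk] at hx
    have : z = 0 := Subtype.ext (eq_zero_of_mem_cycles z.2 fun t =>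
      congrFun (congrArg Subtype.val hx) t)
    rw [this, Submodule.Quotient.mk_zero]
  · intro c
    obtain ⟨c', rfl⟩ := M.restrictChain_surjective _ c
    obtain ⟨z, hz, h⟩ := exists_mem_cycles c'
    exact ⟨Submodule.Quotient.mk ⟨z, hz⟩, Subtype.ext (funext h)⟩

/-- The isomorphism of representations between the top homology of the augmented Bergman complex
and the top oriented chains of the independence complex, given by restriction. -/
def homologyEquivIndepChain (M : Matroid α) [M.Finite] :
    (M.augBergmanHomologyRep M.finRank).Equiv (M.indepChainRep M.finRank) :=
  Representation.Equiv.mk (LinearEquiv.ofBijective M.restrictHomology M.restrictHomology_bijective)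
    fun g => by
      refine LinearMap.ext fun x => ?_
      obtain ⟨z, rfl⟩ := Submodule.Quotient.mk_surjective _ x
      exact restrictChain_chainRep M.finRank g z.1

/-! ### The basis of oriented simplices -/

theorem Indep.isBase_of_ncard_eq_finRank [M.Finite] {B : Set α} (hB : M.Indep B)
    (h : B.ncard = M.finRank) : M.IsBase B := by
  obtain ⟨B', hB', hBB'⟩ := hB.exists_isBase_superset
  rwa [Set.eq_of_subset_of_ncard_le hBB' (by rw [h, ← M.finRank_eq_ncard hB'])
    (M.ground_finite.subset hB'.subset_ground)]

theorem isBase_range_of_isOrderedSimplex [M.Finite] {t : Fin M.finRank → M.E}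
    (ht : M.indepComplex.IsOrderedSimplex t) : M.IsBase (Set.range fun i => (t i : α)) := by
  obtain ⟨hinj, hI⟩ := isOrderedSimplex_indepComplex_iff.mp ht
  refine hI.isBase_of_ncard_eq_finRank ?_
  rw [← Set.image_univ, Set.ncard_image_of_injective _ fun i j h => hinj (Subtype.ext h),
    Set.ncard_univ, Nat.card_fin]

theorem exists_perm_of_range_val_eq {n : ℕ} {v t : Fin n → M.E}
    (hv : M.indepComplex.IsOrderedSimplex v) (ht : M.indepComplex.IsOrderedSimplex t)
    (h : (Set.range fun i => (t i : α)) = Set.range fun i => (v i : α)) :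
    ∃ w : Equiv.Perm (Fin n), t = v ∘ w := by
  refine exists_perm_eq_comp hv.1 ht.1 (Set.image_injective.mpr Subtype.val_injective ?_)
  rw [← Set.range_comp, ← Set.range_comp]
  exact h

section TopChains

variable [M.Finite] {v : {B : Set α // M.IsBase B} → Fin M.finRank → M.E}

theorem range_ordering_ne (hr : ∀ B, Set.range (fun i => (v B i : α)) = B.1)
    {B B' : {B : Set α // M.IsBase B}} (h : B ≠ B') : Set.range (v B) ≠ Set.range (v B') := by
  refine fun h' => h (Subtype.ext ?_)
  rw [← hr B, ← hr B']
  have := congrArg (Subtype.val '' ·) h'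
  simp only [← Set.range_comp] at this
  exact this

/-- A top-degree chain of the independence complex is determined by its values on the chosen
orderings of the bases, which are arbitrary. -/
theorem bijective_apply_orderings (hv : ∀ B, M.indepComplex.IsOrderedSimplex (v B))
    (hr : ∀ B, Set.range (fun i => (v B i : α)) = B.1) :
    Function.Bijective fun (c : M.indepComplex.chain M.finRank) B => c.1 (v B) := by
  classical
  have : Fintype {B : Set α // M.IsBase B} :=
    (M.ground_finite.powerset.subset fun B (hB : M.IsBase B) => hB.subset_ground).fintype
  constructor
  · intro c d hcd
    refine Subtype.ext (funext fun t => ?_)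
    by_cases ht : M.indepComplex.IsOrderedSimplex t
    · obtain ⟨w, hw⟩ := exists_perm_of_range_val_eq
        (hv ⟨_, isBase_range_of_isOrderedSimplex ht⟩) ht (hr ⟨_, _⟩).symm
      rw [hw, chain_apply_comp_perm, chain_apply_comp_perm]
      exact congrArg _ (congrFun hcd _)
    · rw [chain_apply_eq_zero c ht, chain_apply_eq_zero d ht]
  · intro f
    refine ⟨∑ B, f B • M.indepComplex.orientedSimplex (v B) (hv B), funext fun B => ?_⟩
    simp only [Submodule.coe_sum, Submodule.coe_smul, Finset.sum_apply, Pi.smul_apply,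
      smul_eq_mul]
    rw [Finset.sum_eq_single B]
    · rw [orientedSimplex_apply_self, mul_one]
    · intro B' _ hne
      rw [orientedSimplex_apply_eq_zero _ _ (range_ordering_ne hr hne.symm), mul_zero]
    · simp

/-- The basis of the top-degree chain group of the independence complex formed by the oriented
simplices of the chosen orderings of the bases. -/
theorem exists_basis_orientedSimplex (hv : ∀ B, M.indepComplex.IsOrderedSimplex (v B))
    (hr : ∀ B, Set.range (fun i => (v B i : α)) = B.1) :
    ∃ b : Module.Basis {B : Set α // M.IsBase B} ℤ (M.indepComplex.chain M.finRank),
      ∀ B, b B = M.indepComplex.orientedSimplex (v B) (hv B) := by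
  classical
  have : Fintype {B : Set α // M.IsBase B} :=
    (M.ground_finite.powerset.subset fun B (hB : M.IsBase B) => hB.subset_ground).fintype
  let e : M.indepComplex.chain M.finRank ≃ₗ[ℤ] ({B : Set α // M.IsBase B} → ℤ) :=
    LinearEquiv.ofBijective
      { toFun := fun c B => c.1 (v B)
        map_add' := fun _ _ => rfl
        map_smul' := fun _ _ => rfl } (bijective_apply_orderings hv hr)
  refine ⟨Module.Basis.ofEquivFun e, fun B => ?_⟩
  rw [Module.Basis.coe_ofEquivFun, LinearEquiv.symm_apply_eq]
  funext B'
  change _ = (M.indepComplex.orientedSimplex (v B) (hv B)).1 (v B')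
  by_cases h : B' = B
  · subst h
    rw [orientedSimplex_apply_self, Pi.single_eq_same]
  · rw [Pi.single_eq_of_ne h, orientedSimplex_apply_eq_zero _ _ (range_ordering_ne hr h)]

end TopChains

end Matroid

end

theorem corollary1p3 {α : Type*} (M : Matroid α) [M.Finite] :
    ∃ Φ : (M.augBergmanHomologyRep M.finRank).Equiv (M.indepChainRep M.finRank),
      ∀ (v : {B : Set α // M.IsBase B} → Fin M.finRank → M.E)
        (hv : ∀ B, M.indepComplex.IsOrderedSimplex (v B))
        (_ : ∀ B, Set.range (fun i => (v B i : α)) = B.1),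
        ∃ b : Module.Basis {B : Set α // M.IsBase B} ℤ (M.augBergman.reducedHomology M.finRank),
          (∀ B, Φ (b B) = M.indepComplex.orientedSimplex (v B) (hv B)) ∧
          ∀ (g : M.aut) (B : {B : Set α // M.IsBase B}),
            ∃ (B' : {B : Set α // M.IsBase B}) (w : Equiv.Perm (Fin M.finRank)),
              B'.1 = M.permImage g.1 B.1 ∧
              (∀ i, g.1 (v B i) = v B' (w i)) ∧
              M.augBergmanHomologyRep M.finRank g (b B) = (Equiv.Perm.sign w : ℤ) • b B' := by
  refine ⟨M.homologyEquivIndepChain, fun v hv hr => ?_⟩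
  obtain ⟨b, hb⟩ := Matroid.exists_basis_orientedSimplex hv hr
  have hΦ : ∀ B, M.homologyEquivIndepChain (b.map M.homologyEquivIndepChain.toLinearEquiv.symm B) =
      M.indepComplex.orientedSimplex (v B) (hv B) := by
    intro B
    rw [← hb B, Module.Basis.map_apply]
    exact M.homologyEquivIndepChain.toLinearEquiv.apply_symm_apply (b B)
  refine ⟨b.map M.homologyEquivIndepChain.toLinearEquiv.symm, hΦ, fun g B => ?_⟩
  have hgv : M.indepComplex.IsOrderedSimplex (g.1 ∘ v B) := (hv B).comp_aut (M.autIndepComplex g)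
  have hrange : (Set.range fun i => ((g.1 ∘ v B) i : α)) = M.permImage g.1 B.1 := by
    have : Subtype.val ⁻¹' B.1 = Set.range (v B) := by
      rw [← hr B]
      ext x
      simp [Subtype.ext_iff]
    rw [Matroid.permImage, this, ← Set.range_comp, ← Set.range_comp]
    rfl
  obtain ⟨w, hw⟩ := Matroid.exists_perm_of_range_val_eq
    (hv ⟨_, Matroid.isBase_range_of_isOrderedSimplex hgv⟩) hgv (hr ⟨_, _⟩).symm
  refine ⟨⟨_, Matroid.isBase_range_of_isOrderedSimplex hgv⟩, w, hrange, congrFun hw, ?_⟩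
  apply M.homologyEquivIndepChain.toLinearEquiv.injective
  change M.homologyEquivIndepChain _ = M.homologyEquivIndepChain _
  rw [map_smul, hΦ, ← PreAbstractSimplicialComplex.orientedSimplex_comp_perm]
  have h1 : M.homologyEquivIndepChain (M.augBergmanHomologyRep M.finRank g
      (b.map M.homologyEquivIndepChain.toLinearEquiv.symm B)) =
      M.indepChainRep M.finRank g (M.homologyEquivIndepChain
        (b.map M.homologyEquivIndepChain.toLinearEquiv.symm B)) :=
    LinearMap.congr_fun (M.homologyEquivIndepChain.isIntertwining' g) _
  rw [h1, hΦ]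
  refine (PreAbstractSimplicialComplex.chainRep_orientedSimplex _ _ _ _).trans ?_
  congr 1
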